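/- Let $s \ge 3$ be an integer. Let $G = \operatorname{KG}(2s+2,2)_{s\text{-stab}}$ be the $s$-stable Kneser graph whose vertices are the $2$-element subsets $\{i,j\}$ of $\{1,\dots,2s+2\}$ with $s \le |i-j| \le (2s+2)-s$, two vertices being adjacent if and only if they are disjoint. Then $G$ is not hom-idempotent; that is, there is no graph homomorphism (edge-preserving map of vertices) from $G \mathbin{\Box} G$ to $G$, where $G \mathbin{\Box} G$ is the Cartesian product with vertex set $V(G)\times V(G)$, in which two vertices are adjacent if and only if they are equal in one coordinate and adjacent in $G$ in the other. -/

import Mathlib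

/-- The Kneser graph `KG(n,k)`: vertices are the `k`-subsets of an `n`-element set (here
`Fin n = {0, …, n-1}`, the labels `1, …, n` shifted by one); two distinct vertices are adjacent
iff they are disjoint. (Distinctness is automatic for `k ≥ 1`.) -/
def kneserGraph (n k : ℕ) : SimpleGraph {A : Finset (Fin n) // A.card = k} where
  Adj A B := A ≠ B ∧ Disjoint A.1 B.1
  symm := ⟨fun _ _ h => ⟨h.1.symm, h.2.symm⟩⟩
  loopless := ⟨fun _ h => h.1 rfl⟩

/-- A set `A` of points of the `n`-cycle is `s`-stable if `s ≤ |i - j| ≤ n - s` for all distinct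
`i, j ∈ A` (the inequalities are between integers). -/
def IsStableSubset (n s : ℕ) (A : Finset (Fin n)) : Prop :=
  ∀ i ∈ A, ∀ j ∈ A, i ≠ j →
    (s : ℤ) ≤ |(i.val : ℤ) - (j.val : ℤ)| ∧ |(i.val : ℤ) - (j.val : ℤ)| ≤ (n : ℤ) - (s : ℤ)

/-- The `s`-stable Kneser graph: the subgraph of `KG(n,k)` induced by the `s`-stable
`k`-subsets. -/
def stableKneserGraph (n k s : ℕ) :
    SimpleGraph {A : {A : Finset (Fin n) // A.card = k} | IsStableSubset n s A.1} :=
  (kneserGraph n k).induce {A | IsStableSubset n s A.1}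

/-- A graph is hom-idempotent if there is a homomorphism from its Cartesian square to itself. -/
def IsHomIdempotent {V : Type*} (G : SimpleGraph V) : Prop :=
  Nonempty (SimpleGraph.boxProd G G →g G)

/-!
The vertices of the graph in question are the edges of a cubic graph `H`, the circulant graph on
the `(2s+2)`-cycle with steps `s`, `s + 1`, `s + 2`, and two of them are adjacent iff the edges
are disjoint; so it is the complement `G` of the line graph of `H`. About `H` only the following
is used: it is regular of positive degree, triangle-free, connected, has a perfect matching, and
every independent set has fewer than half of the vertices.

An endomorphism `f` of `G` pulls a family of pairwise intersecting edges back to such a family. As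
`H` is triangle-free, such a family lies in a star, so the edges that `f` sends into the star of
`w` lie in the star of some vertex `g w`. Counting incidences, each of these inclusions is an
equality: `w ∈ f e ↔ g w ∈ e` (`exists_mem_apply_iff`). If `w` has a neighbour with the same
image under `g`, then `f` collapses the star of `g w` to one edge; otherwise `g` maps the
neighbourhood of `w` onto that of `g w`. By connectedness one of the two happens for all `w`
simultaneously. In the first case `g` is at most two-to-one with an independent image, which would
be an independent set with half of the vertices. Hence the second case holds, and then `g` is
surjective and `f` maps each star onto a star (`exists_star_image`).

Given a homomorphism `G □ G → G`, fix its second argument to be each edge of a perfect matching in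
turn. This gives endomorphisms `fᵢ` with `fᵢ e` and `fⱼ e` disjoint for every edge `e` and `i ≠ j`.
For a fixed vertex `v` let `fᵢ` map the star of `v` onto the star of `wᵢ`. Then the `wᵢ` are
distinct and pairwise nonadjacent, and there are half as many of them as vertices of `H`: a
contradiction.
-/

/-! ### Hom-idempotency and homomorphic equivalence -/

/-- Hom-idempotency depends only on the homomorphic equivalence class of a graph. -/
theorem IsHomIdempotent.of_hom {V W : Type*} {G : SimpleGraph V} {G' : SimpleGraph W}
    (h : IsHomIdempotent G) (a : G →g G') (b : G' →g G) : IsHomIdempotent G' := by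
  obtain ⟨φ⟩ := h
  refine ⟨⟨fun p => a (φ (b p.1, b p.2)), ?_⟩⟩
  rintro ⟨x, y⟩ ⟨x', y'⟩ hxy
  apply a.map_adj
  apply φ.map_adj
  rcases hxy with ⟨h1, h2⟩ | ⟨h1, h2⟩
  · exact Or.inl ⟨b.map_adj h1, congrArg b h2⟩
  · exact Or.inr ⟨b.map_adj h1, congrArg b h2⟩

/-! ### Endomorphisms of the complement of a line graph -/

namespace SimpleGraph

variable {V : Type*} {H : SimpleGraph V}

theorem lineGraph_compl_adj_iff {e e' : H.edgeSet} :
    (H.lineGraph)ᶜ.Adj e e' ↔ ∀ v, v ∈ e.1 → v ∉ e'.1 := by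
  rw [compl_adj, lineGraph_adj_iff_exists]
  constructor
  · rintro ⟨hne, h⟩ v hv hv'
    exact h ⟨hne, v, hv, hv'⟩
  · intro h
    refine ⟨?_, fun ⟨_, v, hv, hv'⟩ => h v hv hv'⟩
    rintro rfl
    exact h _ (Sym2.out_fst_mem e.1) (Sym2.out_fst_mem e.1)

/-- In a triangle-free graph a family of pairwise intersecting edges is contained in a star. -/
theorem CliqueFree.exists_mem_of_pairwise_intersecting [Nonempty V] (hH : H.CliqueFree 3)
    (P : H.edgeSet → Prop)
    (hP : ∀ e e', P e → P e' → ∃ v, v ∈ e.1 ∧ v ∈ e'.1) : ∃ v, ∀ e, P e → v ∈ e.1 := by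
  classical
  by_cases h0 : ∃ e, P e
  swap
  · exact ⟨Classical.arbitrary V, fun e he => (h0 ⟨e, he⟩).elim⟩
  obtain ⟨⟨e₀, h₀⟩, he₀⟩ := h0
  induction e₀ using Sym2.ind with
  | _ a b =>
  by_contra! hno
  obtain ⟨e₁, hP₁, ha₁⟩ := hno a
  obtain ⟨e₂, hP₂, hb₂⟩ := hno b
  have hb₁ : b ∈ e₁.1 := by
    obtain ⟨v, hv, hv'⟩ := hP _ _ he₀ hP₁
    rcases Sym2.mem_iff.1 hv with rfl | rfl
    · exact (ha₁ hv').elim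
    · exact hv'
  have ha₂ : a ∈ e₂.1 := by
    obtain ⟨v, hv, hv'⟩ := hP _ _ he₀ hP₂
    rcases Sym2.mem_iff.1 hv with rfl | rfl
    · exact hv'
    · exact (hb₂ hv').elim
  obtain ⟨c, hc₁, hc₂⟩ := hP _ _ hP₁ hP₂
  have hca : c ≠ a := by rintro rfl; exact ha₁ hc₁
  have hcb : c ≠ b := by rintro rfl; exact hb₂ hc₂
  have h1 : e₁.1 = s(b, c) := (Sym2.mem_and_mem_iff hcb.symm).1 ⟨hb₁, hc₁⟩
  have h2 : e₂.1 = s(a, c) := (Sym2.mem_and_mem_iff hca.symm).1 ⟨ha₂, hc₂⟩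
  have hab : H.Adj a b := h₀
  have hbc : H.Adj b c := by have := e₁.2; rwa [h1] at this
  have hac : H.Adj a c := by have := e₂.2; rwa [h2] at this
  exact hH {a, b, c} (is3Clique_triple_iff.2 ⟨hab, hac, hbc⟩)

/-- A property that passes to neighbours holds on a whole connected graph as soon as it holds
somewhere. -/
theorem Preconnected.forall_of_adj (hH : H.Preconnected) {P : V → Prop}
    (hP : ∀ v w, P v → H.Adj v w → P w) {v : V} (hv : P v) (w : V) : P w := by
  obtain ⟨p⟩ := hH v w
  induction p with
  | nil => exact hv
  | cons h _ ih => exact ih (hP _ _ hv h)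

/-- The value of `f` at the edge `e` is `ww'` as soon as `g w` and `g w'` lie on `e`. -/
theorem apply_eq_of_mem {f : H.edgeSet → H.edgeSet} {g : V → V}
    (hfg : ∀ w e, w ∈ (f e).1 ↔ g w ∈ e.1) {w w' : V}
    (hne : w ≠ w') {e : H.edgeSet} (h : g w ∈ e.1) (h' : g w' ∈ e.1) : (f e).1 = s(w, w') :=
  (Sym2.mem_and_mem_iff hne).1 ⟨(hfg w e).2 h, (hfg w' e).2 h'⟩

theorem card_filter_mem_of_edge [Fintype V] [DecidableEq V] (e : H.edgeSet) :
    (Finset.univ.filter fun v : V => v ∈ e.1).card = 2 := by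
  rw [← Sym2.card_toFinset_of_not_isDiag e.1 (H.not_isDiag_of_mem_edgeSet e.2)]
  congr 1
  ext v
  simp

variable [Fintype V] [DecidableEq V] [DecidableRel H.Adj]

theorem card_filter_mem_edge (v : V) :
    (Finset.univ.filter fun e : H.edgeSet => v ∈ e.1).card = H.degree v := by
  rw [← card_incidenceFinset_eq_degree]
  refine Finset.card_bij (fun e _ => e.1) ?_ ?_ ?_
  · intro e he
    rw [mem_incidenceFinset]
    exact ⟨e.2, (Finset.mem_filter.1 he).2⟩
  · intro e _ e' _ h
    exact Subtype.ext h
  · intro e he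
    rw [mem_incidenceFinset] at he
    exact ⟨⟨e, he.1⟩, by simpa using he.2, rfl⟩

variable {d : ℕ}

/-- An endomorphism `f` of the complement of the line graph pulls every star back to a star.
Pulled back stars lie in stars by triangle-freeness; as `f` preserves the total number of
incidences and all stars have the same size, nothing is lost. -/
theorem exists_mem_apply_iff (hreg : H.IsRegularOfDegree d) (hfree : H.CliqueFree 3)
    (f : (H.lineGraph)ᶜ →g (H.lineGraph)ᶜ) :
    ∃ g : V → V, ∀ w e, w ∈ (f e).1 ↔ g w ∈ e.1 := by
  have key : ∀ w : V, ∃ v, ∀ e, w ∈ (f e).1 → v ∈ e.1 := by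
    intro w
    have : Nonempty V := ⟨w⟩
    refine hfree.exists_mem_of_pairwise_intersecting (fun e => w ∈ (f e).1) ?_
    intro e e' he he'
    by_contra! hcon
    exact lineGraph_compl_adj_iff.1 (f.map_adj (lineGraph_compl_adj_iff.2 hcon)) w he he'
  choose g hg using key
  refine ⟨g, ?_⟩
  have hsub : ∀ w, (Finset.univ.filter fun e : H.edgeSet => w ∈ (f e).1) ⊆
      Finset.univ.filter fun e : H.edgeSet => g w ∈ e.1 := by
    intro w e he
    simpa using hg w e (Finset.mem_filter.1 he).2
  have hsum : ∑ w : V, (Finset.univ.filter fun e : H.edgeSet => w ∈ (f e).1).card =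
      ∑ w : V, (Finset.univ.filter fun e : H.edgeSet => g w ∈ e.1).card := by
    calc ∑ w : V, (Finset.univ.filter fun e : H.edgeSet => w ∈ (f e).1).card
        = ∑ e : H.edgeSet, (Finset.univ.filter fun w : V => w ∈ (f e).1).card :=
          Finset.sum_card_bipartiteAbove_eq_sum_card_bipartiteBelow
            (fun (w : V) (e : H.edgeSet) => w ∈ (f e).1)
      _ = ∑ e : H.edgeSet, (Finset.univ.filter fun w : V => w ∈ e.1).card := by
          refine Finset.sum_congr rfl fun e _ => ?_
          rw [card_filter_mem_of_edge, card_filter_mem_of_edge]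
      _ = ∑ w : V, (Finset.univ.filter fun e : H.edgeSet => w ∈ e.1).card :=
          (Finset.sum_card_bipartiteAbove_eq_sum_card_bipartiteBelow
            (fun (w : V) (e : H.edgeSet) => w ∈ e.1)).symm
      _ = ∑ w : V, (Finset.univ.filter fun e : H.edgeSet => g w ∈ e.1).card := by
          refine Finset.sum_congr rfl fun w _ => ?_
          rw [card_filter_mem_edge, card_filter_mem_edge, hreg w, hreg (g w)]
  have hcard := (Finset.sum_eq_sum_iff_of_le fun w _ => Finset.card_le_card (hsub w)).1 hsum
  intro w e
  have := Finset.eq_of_subset_of_card_le (hsub w) (hcard w (Finset.mem_univ w)).ge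
  simpa using Finset.ext_iff.1 this e

section

variable {f : H.edgeSet → H.edgeSet} {g : V → V}

/-- If `g` separates `w` from its neighbours, it maps the neighbourhood of `w` onto the
neighbourhood of `g w`. -/
theorem image_neighborFinset (hreg : H.IsRegularOfDegree d)
    (hfg : ∀ w e, w ∈ (f e).1 ↔ g w ∈ e.1) {w : V} (hw : ∀ w', H.Adj w w' → g w' ≠ g w) :
    (H.neighborFinset w).image g = H.neighborFinset (g w) := by
  symm
  apply Finset.eq_of_subset_of_card_le
  · intro u hu
    rw [mem_neighborFinset] at hu
    set e : H.edgeSet := ⟨s(g w, u), hu⟩ with he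
    have hwe : w ∈ (f e).1 := (hfg w e).2 (Sym2.mem_mk_left _ _)
    obtain ⟨w', hw'⟩ := Sym2.mem_iff_exists.1 hwe
    have hadj : H.Adj w w' := by have := (f e).2; rwa [hw'] at this
    have hmem : g w' ∈ e.1 := (hfg w' e).1 (by rw [hw']; exact Sym2.mem_mk_right _ _)
    rcases Sym2.mem_iff.1 hmem with h | h
    · exact (hw w' hadj h).elim
    · exact Finset.mem_image.2 ⟨w', by simpa using hadj, h⟩
  · refine Finset.card_image_le.trans ?_
    rw [card_neighborFinset_eq_degree, card_neighborFinset_eq_degree, hreg, hreg]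

/-- If every vertex `w` had a neighbour with the same image under `g`, then `g` would be at most
two-to-one with an independent image, so there would be an independent set with half of the
vertices. -/
theorem card_le_two_mul_card_image (hreg : H.IsRegularOfDegree d) (hd : 0 < d)
    (hfg : ∀ w e, w ∈ (f e).1 ↔ g w ∈ e.1) (hbad : ∀ w, ∃ w', H.Adj w w' ∧ g w' = g w) :
    H.IsIndepSet (Finset.univ.image g : Finset V) ∧
      Fintype.card V ≤ 2 * (Finset.univ.image g).card := by
  constructor
  · intro v hv v' hv' _ hadj
    rw [Finset.mem_coe, Finset.mem_image] at hv hv'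
    obtain ⟨w, -, rfl⟩ := hv
    obtain ⟨w', -, rfl⟩ := hv'
    have hne : w ≠ w' := by rintro rfl; exact H.loopless.irrefl _ hadj
    obtain ⟨x, hx, hgx⟩ := hbad w
    set e : H.edgeSet := ⟨s(g w, g w'), hadj⟩
    have he := apply_eq_of_mem hfg hne (e := e) (Sym2.mem_mk_left _ _) (Sym2.mem_mk_right _ _)
    have hxe : x ∈ (f e).1 := (hfg x e).2 (by rw [hgx]; exact Sym2.mem_mk_left _ _)
    rw [he] at hxe
    rcases Sym2.mem_iff.1 hxe with rfl | rfl
    · exact hx.ne rfl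
    · rw [hgx] at hadj
      exact H.loopless.irrefl _ hadj
  · rw [← Finset.card_univ]
    refine Finset.card_le_mul_card_image _ _ ?_
    intro v hv
    obtain ⟨w, -, rfl⟩ := Finset.mem_image.1 hv
    -- All of the fibre lies on the image of any one edge at `g w`.
    obtain ⟨u, hu⟩ : ∃ u, H.Adj (g w) u := by
      rw [← H.degree_pos_iff_exists_adj, hreg]
      exact hd
    rw [← card_filter_mem_of_edge (f ⟨s(g w, u), hu⟩)]
    apply Finset.card_le_card
    intro x hx
    simp only [Finset.mem_filter, Finset.mem_univ, true_and] at hx ⊢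
    exact (hfg x _).2 (by rw [hx]; exact Sym2.mem_mk_left _ _)

end

/-- An endomorphism of the complement of the line graph maps the star of each vertex `v` onto the
star of some vertex `w`. -/
theorem exists_star_image (hreg : H.IsRegularOfDegree d) (hd : 0 < d) (hfree : H.CliqueFree 3)
    (hconn : H.Preconnected)
    (hindep : ∀ S : Finset V, H.IsIndepSet S → 2 * S.card < Fintype.card V)
    (f : (H.lineGraph)ᶜ →g (H.lineGraph)ᶜ) (v : V) :
    ∃ w, (∀ e : H.edgeSet, v ∈ e.1 → w ∈ (f e).1) ∧
      ∀ w', H.Adj w w' → ∃ e : H.edgeSet, v ∈ e.1 ∧ (f e).1 = s(w, w') := by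
  obtain ⟨g, hfg⟩ := exists_mem_apply_iff hreg hfree f
  obtain ⟨w₀, hw₀⟩ : ∃ w, ∀ w', H.Adj w w' → g w' ≠ g w := by
    by_contra! hbad
    obtain ⟨h1, h2⟩ := card_le_two_mul_card_image (f := f) hreg hd hfg hbad
    exact absurd (hindep _ h1) (by omega)
  have hadj : ∀ {w w'}, (∀ x, H.Adj w x → g x ≠ g w) → H.Adj w w' → H.Adj (g w) (g w') := by
    intro w w' hw hww'
    rw [← mem_neighborFinset, ← image_neighborFinset (f := f) hreg hfg hw]
    exact Finset.mem_image_of_mem g (by simpa using hww')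
  have hgood : ∀ w w', H.Adj w w' → g w' ≠ g w := by
    intro w
    refine hconn.forall_of_adj (P := fun w => ∀ x, H.Adj w x → g x ≠ g w) ?_ hw₀ w
    intro w w' hw hww' x hx hgx
    have hg := hadj hw hww'
    -- The edge `g w, g w'` would be sent to both `w, w'` and `w', x`.
    have h1 := apply_eq_of_mem (f := f) hfg hww'.ne (e := ⟨s(g w, g w'), hg⟩)
      (Sym2.mem_mk_left _ _) (Sym2.mem_mk_right _ _)
    have h2 : x ∈ (f ⟨s(g w, g w'), hg⟩).1 :=
      (hfg x _).2 (by rw [hgx]; exact Sym2.mem_mk_right _ _)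
    rw [h1] at h2
    rcases Sym2.mem_iff.1 h2 with rfl | rfl
    · exact hg.ne hgx
    · exact hx.ne rfl
  obtain ⟨w, rfl⟩ : ∃ w, g w = v := by
    refine hconn.forall_of_adj (P := fun v => ∃ w, g w = v) ?_ ⟨w₀, rfl⟩ v
    rintro _ u ⟨w, rfl⟩ hu
    rw [← mem_neighborFinset, ← image_neighborFinset (f := f) hreg hfg (hgood w)] at hu
    obtain ⟨w', -, rfl⟩ := Finset.mem_image.1 hu
    exact ⟨w', rfl⟩
  refine ⟨w, fun e he => (hfg w e).2 he, fun w' hw' => ?_⟩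
  exact ⟨⟨s(g w, g w'), hadj (hgood w) hw'⟩, Sym2.mem_mk_left _ _,
    apply_eq_of_mem (f := f) hfg hw'.ne (Sym2.mem_mk_left _ _) (Sym2.mem_mk_right _ _)⟩

/-- The family `p` plays the part of a perfect matching: it consists of pairwise disjoint edges and
has at least half as many members as there are vertices. -/
theorem not_isHomIdempotent_compl_lineGraph [Nonempty V] (hreg : H.IsRegularOfDegree d)
    (hd : 0 < d) (hfree : H.CliqueFree 3) (hconn : H.Preconnected)
    (hindep : ∀ S : Finset V, H.IsIndepSet S → 2 * S.card < Fintype.card V)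
    {ι : Type*} [Fintype ι] (p : ι → H.edgeSet)
    (hp : Pairwise fun i j => (H.lineGraph)ᶜ.Adj (p i) (p j))
    (hcard : Fintype.card V ≤ 2 * Fintype.card ι) :
    ¬ IsHomIdempotent (H.lineGraph)ᶜ := by
  rintro ⟨φ⟩
  let v : V := Classical.arbitrary V
  let f : ι → ((H.lineGraph)ᶜ →g (H.lineGraph)ᶜ) := fun i =>
    ⟨fun e => φ (e, p i), fun h => φ.map_adj (boxProd_adj_left.2 h)⟩
  have hf : ∀ i j, i ≠ j → ∀ e x, x ∈ (f i e).1 → x ∉ (f j e).1 := fun i j hij e =>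
    lineGraph_compl_adj_iff.1 (φ.map_adj (boxProd_adj_right.2 (hp hij)))
  choose w hw hw' using fun i => exists_star_image hreg hd hfree hconn hindep (f i) v
  obtain ⟨u, hu⟩ : ∃ u, H.Adj v u := by
    rw [← H.degree_pos_iff_exists_adj, hreg]
    exact hd
  have hinj : Function.Injective w := by
    intro i j hij
    by_contra hne
    have he : v ∈ (⟨s(v, u), hu⟩ : H.edgeSet).1 := Sym2.mem_mk_left _ _
    exact hf i j hne _ (w i) (hw i _ he) (by rw [hij]; exact hw j _ he)
  have hI : H.IsIndepSet (Finset.univ.image w : Finset V) := by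
    intro x hx y hy hxy hadj
    rw [Finset.mem_coe, Finset.mem_image] at hx hy
    obtain ⟨i, -, rfl⟩ := hx
    obtain ⟨j, -, rfl⟩ := hy
    have hij : i ≠ j := by rintro rfl; exact hxy rfl
    obtain ⟨e, he, hfe⟩ := hw' i _ hadj
    exact hf i j hij e (w j) (by rw [hfe]; exact Sym2.mem_mk_right _ _) (hw j e he)
  have h1 := hindep _ hI
  rw [Finset.card_image_of_injective _ hinj, Finset.card_univ] at h1
  omega

end SimpleGraph

/-! ### The circulant graph of stable pairs -/

/-- The graph on the points of the `(2s+2)`-cycle whose edges are the `s`-stable pairs: two points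
are adjacent iff they are at cyclic distance `s` or `s + 1`, that is, iff `s ≤ |i - j| ≤ s + 2`. The
absolute value is written as a sum of two truncated differences, one of which vanishes. -/
def stablePairGraph (s : ℕ) (hs : 3 ≤ s) : SimpleGraph (Fin (2 * s + 2)) where
  Adj i j := s ≤ (i.val - j.val) + (j.val - i.val) ∧ (i.val - j.val) + (j.val - i.val) ≤ s + 2
  symm := ⟨fun _ _ h => by omega⟩
  loopless := ⟨fun _ h => by omega⟩

instance (s : ℕ) (hs : 3 ≤ s) : DecidableRel (stablePairGraph s hs).Adj := fun i j =>
  inferInstanceAs (Decidable (s ≤ (i.val - j.val) + (j.val - i.val) ∧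
    (i.val - j.val) + (j.val - i.val) ≤ s + 2))

namespace stablePairGraph

variable {s : ℕ} (hs : 3 ≤ s)

theorem adj_iff {i j : Fin (2 * s + 2)} : (stablePairGraph s hs).Adj i j ↔
    s ≤ (i.val - j.val) + (j.val - i.val) ∧ (i.val - j.val) + (j.val - i.val) ≤ s + 2 := Iff.rfl

theorem isRegularOfDegree : (stablePairGraph s hs).IsRegularOfDegree 3 := by
  intro i
  -- `t k` is the point `i + k` of the cycle.
  let t : ∀ k, k ≤ s + 2 → Fin (2 * s + 2) := fun k hk =>
    if h : i.val + k < 2 * s + 2 then ⟨i.val + k, h⟩ else ⟨i.val + k - (2 * s + 2), by omega⟩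
  have ht : ∀ k hk, (t k hk).val = if i.val + k < 2 * s + 2 then i.val + k
      else i.val + k - (2 * s + 2) := by
    intro k hk
    simp only [t]
    split_ifs <;> rfl
  have h0 := ht s (by omega)
  have h1 := ht (s + 1) (by omega)
  have h2 := ht (s + 2) le_rfl
  rw [← SimpleGraph.card_neighborFinset_eq_degree, Finset.card_eq_three]
  refine ⟨t s (by omega), t (s + 1) (by omega), t (s + 2) le_rfl, ?_, ?_, ?_, ?_⟩
  · rw [Ne, Fin.ext_iff]; split_ifs at h0 h1 h2 <;> omega
  · rw [Ne, Fin.ext_iff]; split_ifs at h0 h1 h2 <;> omega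
  · rw [Ne, Fin.ext_iff]; split_ifs at h0 h1 h2 <;> omega
  · ext j
    simp only [SimpleGraph.mem_neighborFinset, adj_iff, Finset.mem_insert, Finset.mem_singleton,
      Fin.ext_iff]
    have := i.2
    have := j.2
    split_ifs at h0 h1 h2 <;> omega

theorem cliqueFree_three : (stablePairGraph s hs).CliqueFree 3 := by
  intro t ht
  obtain ⟨a, b, c, hab, hac, hbc, -⟩ := SimpleGraph.is3Clique_iff.1 ht
  rw [adj_iff] at hab hac hbc
  omega

/-- The points `i` and `i + 1` have a common neighbour, so all points are connected to `0`. -/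
theorem preconnected : (stablePairGraph s hs).Preconnected := by
  have key : ∀ k (hk : k < 2 * s + 2),
      (stablePairGraph s hs).Reachable ⟨0, by omega⟩ ⟨k, hk⟩ := by
    intro k
    induction k with
    | zero => intro _; exact SimpleGraph.Reachable.refl _
    | succ k ih =>
      intro hk
      refine (ih (by omega)).trans ?_
      by_cases h : k + s + 1 < 2 * s + 2
      · refine SimpleGraph.Reachable.trans (v := ⟨k + s + 1, h⟩) ?_ ?_
        all_goals
          apply SimpleGraph.Adj.reachable
          rw [adj_iff]
          dsimp only
          omega
      · refine SimpleGraph.Reachable.trans (v := ⟨k - s - 1, by omega⟩) ?_ ?_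
        all_goals
          apply SimpleGraph.Adj.reachable
          rw [adj_iff]
          dsimp only
          omega
  intro i j
  exact (key i.1 i.2).symm.trans (key j.1 j.2)

/-- The antipode of a point of the cycle. -/
def antipode (i : Fin (2 * s + 2)) : Fin (2 * s + 2) :=
  if h : i.val < s + 1 then ⟨i.val + (s + 1), by omega⟩ else ⟨i.val - (s + 1), by omega⟩

theorem antipode_val (i : Fin (2 * s + 2)) :
    (antipode i).val = if i.val < s + 1 then i.val + (s + 1) else i.val - (s + 1) := by
  unfold antipode
  split_ifs <;> rfl

/-- An independent set with half of the points would contain exactly one of any two antipodes, and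
would then be closed under passing from `i` to `i + 1` and to `i - 1`, whose antipodes are neighbours
of `i`. -/
theorem two_mul_card_lt_of_isIndepSet (S : Finset (Fin (2 * s + 2)))
    (hS : (stablePairGraph s hs).IsIndepSet S) :
    2 * S.card < Fintype.card (Fin (2 * s + 2)) := by
  by_contra! hcard
  have hadj : ∀ i j, i ∈ S → (stablePairGraph s hs).Adj i j → j ∉ S :=
    fun i j hi h hj => hS hi hj h.ne h
  have hanti : ∀ i, (stablePairGraph s hs).Adj i (antipode i) := by
    intro i
    have := antipode_val i
    rw [adj_iff]
    split_ifs at this <;> omega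
  have hinj : Function.Injective (antipode (s := s)) := by
    intro i j hij
    have h1 := antipode_val i
    have h2 := antipode_val j
    rw [hij] at h1
    apply Fin.ext
    have := i.2
    have := j.2
    split_ifs at h1 h2 <;> omega
  have hdisj : Disjoint S (S.image antipode) := by
    rw [Finset.disjoint_left]
    intro x hx hx'
    obtain ⟨i, hi, rfl⟩ := Finset.mem_image.1 hx'
    exact hadj i _ hi (hanti i) hx
  have huniv : S ∪ S.image antipode = Finset.univ := by
    apply Finset.eq_univ_of_card
    apply le_antisymm (Finset.card_le_univ _)
    rw [Finset.card_union_of_disjoint hdisj, Finset.card_image_of_injective _ hinj]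
    omega
  -- A point whose antipode is adjacent to a point of `S` belongs to `S`.
  have hstep : ∀ i j, i ∈ S → (stablePairGraph s hs).Adj i (antipode j) → j ∈ S := by
    intro i j hi hij
    have hj := hadj i _ hi hij
    have hmem : antipode j ∈ S ∪ S.image antipode := by rw [huniv]; exact Finset.mem_univ _
    rcases Finset.mem_union.1 hmem with h | h
    · exact (hj h).elim
    · obtain ⟨j', hj', h⟩ := Finset.mem_image.1 h
      rwa [← hinj h]
  have hnext : ∀ i j : Fin (2 * s + 2), (i.val + 1 = j.val ∨ j.val + 1 = i.val) →
      i ∈ S → j ∈ S := by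
    intro i j hij hi
    refine hstep i j hi ?_
    have := antipode_val j
    rw [adj_iff]
    have := i.2
    have := j.2
    split_ifs at * <;> omega
  have hpos : 0 < S.card := by
    rw [Fintype.card_fin] at hcard
    omega
  obtain ⟨i, hi⟩ := Finset.card_pos.1 hpos
  have h0 : (⟨0, by omega⟩ : Fin (2 * s + 2)) ∈ S := by
    have : ∀ k (hk : k < 2 * s + 2), (⟨k, hk⟩ : Fin (2 * s + 2)) ∈ S →
        (⟨0, by omega⟩ : Fin (2 * s + 2)) ∈ S := by
      intro k
      induction k with
      | zero => exact fun _ h => h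
      | succ k ih => exact fun hk h => ih (by omega) (hnext _ _ (Or.inr rfl) h)
    exact this i.1 i.2 hi
  have hall : ∀ k (hk : k < 2 * s + 2), (⟨k, hk⟩ : Fin (2 * s + 2)) ∈ S := by
    intro k
    induction k with
    | zero => exact fun _ => h0
    | succ k ih => exact fun hk => hnext _ _ (Or.inl rfl) (ih (by omega))
  exact hadj i _ hi (hanti i) (hall _ (antipode i).2)

/-- The perfect matching that joins antipodes. -/
def antipodalEdge (i : Fin (s + 1)) : (stablePairGraph s hs).edgeSet :=
  ⟨s(⟨i.val, by omega⟩, ⟨i.val + (s + 1), by omega⟩), by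
    rw [SimpleGraph.mem_edgeSet, adj_iff]
    dsimp only
    omega⟩

theorem pairwise_adj_antipodalEdge : Pairwise fun i j =>
    (stablePairGraph s hs).lineGraphᶜ.Adj (antipodalEdge hs i) (antipodalEdge hs j) := by
  intro i j hij
  have hne : i.val ≠ j.val := fun h => hij (Fin.ext h)
  have := i.2
  have := j.2
  rw [SimpleGraph.lineGraph_compl_adj_iff]
  intro v hv hv'
  simp only [antipodalEdge, Sym2.mem_iff, Fin.ext_iff] at hv hv'
  omega

/-! ### Stable pairs as edges -/

/-- Being `s`-stable, for a pair of points, means being an edge of `stablePairGraph`. -/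
theorem isStableSubset_toFinset (e : (stablePairGraph s hs).edgeSet) :
    IsStableSubset (2 * s + 2) s e.1.toFinset := by
  obtain ⟨e, he⟩ := e
  induction e using Sym2.ind with
  | _ a b =>
  rw [SimpleGraph.mem_edgeSet, adj_iff] at he
  intro i hi j hj hij
  rw [Sym2.mem_toFinset, Sym2.mem_iff] at hi hj
  rcases hi with rfl | rfl <;> rcases hj with rfl | rfl
  · exact (hij rfl).elim
  · rcases abs_cases ((i.val : ℤ) - (j.val : ℤ)) with ⟨h, _⟩ | ⟨h, _⟩ <;>
      rw [h] <;> push_cast <;> omega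
  · rcases abs_cases ((i.val : ℤ) - (j.val : ℤ)) with ⟨h, _⟩ | ⟨h, _⟩ <;>
      rw [h] <;> push_cast <;> omega
  · exact (hij rfl).elim

theorem exists_edge_of_isStableSubset {A : Finset (Fin (2 * s + 2))} (hA : A.card = 2)
    (hst : IsStableSubset (2 * s + 2) s A) :
    ∃ e : (stablePairGraph s hs).edgeSet, ∀ v, v ∈ e.1 ↔ v ∈ A := by
  obtain ⟨a, b, hab, rfl⟩ := Finset.card_eq_two.1 hA
  have h := hst a (by simp) b (by simp) hab
  refine ⟨⟨s(a, b), ?_⟩, by simp⟩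
  rw [SimpleGraph.mem_edgeSet, adj_iff]
  rcases abs_cases ((a.val : ℤ) - (b.val : ℤ)) with ⟨h', _⟩ | ⟨h', _⟩ <;>
    rw [h'] at h <;> push_cast at h <;> omega

theorem nonempty_hom_to_stableKneserGraph :
    Nonempty ((stablePairGraph s hs).lineGraphᶜ →g stableKneserGraph (2 * s + 2) 2 s) := by
  refine ⟨⟨fun e => ⟨⟨e.1.toFinset, Sym2.card_toFinset_of_not_isDiag _
    (SimpleGraph.not_isDiag_of_mem_edgeSet _ e.2)⟩, isStableSubset_toFinset hs e⟩, ?_⟩⟩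
  intro e e' h
  rw [SimpleGraph.lineGraph_compl_adj_iff] at h
  have hd : Disjoint e.1.toFinset e'.1.toFinset := by
    rw [Finset.disjoint_left]
    simpa using h
  refine ⟨fun heq => ?_, hd⟩
  have heq' : e.1.toFinset = e'.1.toFinset := congrArg Subtype.val heq
  rw [← heq', Finset.disjoint_self_iff_empty] at hd
  exact Sym2.toFinset_ne_empty _ hd

theorem nonempty_hom_from_stableKneserGraph :
    Nonempty (stableKneserGraph (2 * s + 2) 2 s →g (stablePairGraph s hs).lineGraphᶜ) := by
  choose F hF using fun A : {A : {A : Finset (Fin (2 * s + 2)) // A.card = 2} |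
    IsStableSubset (2 * s + 2) s A.1} => exists_edge_of_isStableSubset hs A.1.2 A.2
  refine ⟨⟨F, ?_⟩⟩
  intro A B h
  rw [SimpleGraph.lineGraph_compl_adj_iff]
  intro v hv hv'
  exact Finset.disjoint_left.1 h.2 ((hF A v).1 hv) ((hF B v).1 hv')

end stablePairGraph

theorem mainTheorem4 (s : ℕ) (hs : 3 ≤ s) :
    ¬ IsHomIdempotent (stableKneserGraph (2 * s + 2) 2 s) := by
  intro h
  obtain ⟨a⟩ := stablePairGraph.nonempty_hom_from_stableKneserGraph hs
  obtain ⟨b⟩ := stablePairGraph.nonempty_hom_to_stableKneserGraph hs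
  refine SimpleGraph.not_isHomIdempotent_compl_lineGraph
    (stablePairGraph.isRegularOfDegree hs) (by norm_num) (stablePairGraph.cliqueFree_three hs)
    (stablePairGraph.preconnected hs) (stablePairGraph.two_mul_card_lt_of_isIndepSet hs)
    (stablePairGraph.antipodalEdge hs) (stablePairGraph.pairwise_adj_antipodalEdge hs) ?_
    (h.of_hom a b)
  rw [Fintype.card_fin, Fintype.card_fin]
  omega
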